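/- For integers $n\ge 3$ let $f_1(n)=\dfrac{\sigma(n)}{n\log\log n}$ and $f_2(n)=\dfrac{n}{\varphi(n)\log\log n}$, where $\sigma(n)$ is the sum of the positive divisors of $n$ and $\varphi$ is Euler's totient function, and let $\gamma$ be the Euler–Mascheroni constant. Call a positive integer $n$ squarefull if $p^2\mid n$ for every prime divisor $p$ of $n$. Then $$(1)\ \limsup_{n\to\infty} f_1(n)=e^{\gamma},\qquad (2)\ \limsup_{\substack{n\to\infty\\ n\text{ squarefree}}} f_1(n)=\frac{6e^{\gamma}}{\pi^2},\qquad (3)\ \limsup_{\substack{n\to\infty\\ n\text{ odd}}} f_1(n)=\frac{e^{\gamma}}{2},$$ $$(4)\ \limsup_{n\to\infty} f_2(n)=e^{\gamma},\qquad (5)\ \limsup_{\substack{n\to\infty\\ n\text{ squarefree}}} f_2(n)=e^{\gamma},\qquad (6)\ \limsup_{\substack{n\to\infty\\ n\text{ odd}}} f_2(n)=\frac{e^{\gamma}}{2},$$ $$(7)\ \limsup_{\substack{n\to\infty\\ n\text{ squarefull}}} f_1(n)=e^{\gamma},\qquad (8)\ \limsup_{\substack{n\to\infty\\ n\text{ squarefull}}}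 f_2(n)=e^{\gamma}.$$ -/

import Mathlib

open Filter

/-- The ratio `σ(n) / (n log log n)`, where `σ(n)` is the sum of the positive divisors of `n`. -/
noncomputable def f₁ (n : ℕ) : ℝ :=
  (ArithmeticFunction.sigma 1 n : ℝ) / ((n : ℝ) * Real.log (Real.log (n : ℝ)))

/-- The ratio `n / (φ(n) log log n)`, where `φ` is Euler's totient function. -/
noncomputable def f₂ (n : ℕ) : ℝ :=
  (n : ℝ) / ((Nat.totient n : ℝ) * Real.log (Real.log (n : ℝ)))

/-- A positive integer is squarefull if the square of each of its prime divisors divides it. -/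
def Squarefull (n : ℕ) : Prop :=
  0 < n ∧ ∀ p : ℕ, p.Prime → p ∣ n → p ^ 2 ∣ n

/-- The upper limit of `f n` as `n` tends to infinity through the set `S`, as an extended real
number (so that no boundedness of `f` is presupposed; it is `⊥` if `S` is finite). -/
noncomputable def limsupOver (S : Set ℕ) (f : ℕ → ℝ) : EReal :=
  limsup (fun n : ℕ => (f n : EReal)) (atTop ⊓ 𝓟 S)

open Topology

/-! Both ratios are products over the primes dividing `n`: `n / φ(n)` has the factors `(1 - 1/p)⁻¹`,
and `σ(n) / n` has the same factors multiplied by `1 - p^(-(k+1))`, where `k` is the exponent of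
`p`.

Upper bound (`prod_primeFactors_le`): `n` has at most `log n / log log n` prime factors above `log
n`, and together they contribute a factor tending to 1. The others are primes up to `log n`, where
Mertens' third theorem gives `e^γ log log n`. Leaving out the prime 2 halves this. For squarefree
`n` the factors of `σ(n) / n` are `1 + 1/p = (1 - 1/p²)(1 - 1/p)⁻¹`, which brings in `1 / ζ(2) = 6 /
π²`.

Lower bound (`tendsto_nat_and_exists_tendsto_le`): take a high power of the product of the
admissible primes up to `N`, or the primorial in the squarefree case. For these `log log n ≤ (1 +
o(1)) log N`.

Mertens' third theorem, with its constant, is proved on the way. Chebyshev's bound and Stirling's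
formula give the first theorem. Partial summation over the blocks `m < log p ≤ m + 1` shows that the
sum of `1/p` minus a harmonic number converges. Abel's limit theorem identifies the limit through
the pole of `ζ` at 1, and `γ` enters by comparing the harmonic numbers with the logarithm. -/

/-! ### Mertens' first theorem, from the factorization of `N!`. -/

theorem Real.log_factorial_eq_sum_primesLE (N : ℕ) :
    Real.log (N.factorial : ℝ)
      = ∑ p ∈ N.primesLE, (N.factorial.factorization p : ℝ) * Real.log p := by
  rw [Real.log_nat_eq_sum_factorization]
  refine Finsupp.sum_of_support_subset _ (fun p hp => ?_) _ (by simp)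
  rw [Nat.support_factorization, Nat.mem_primeFactors] at hp
  exact Nat.mem_primesLE.2 ⟨(hp.1.dvd_factorial).1 hp.2.1, hp.1⟩

theorem Nat.div_le_factorization_factorial {p N : ℕ} (hp : p.Prime) :
    N / p ≤ N.factorial.factorization p := by
  rw [Nat.factorization_factorial hp (b := Nat.log p N + 2) (by omega)]
  have := Finset.single_le_sum (f := fun i => N / p ^ i) (s := Finset.Ico 1 (Nat.log p N + 2))
    (fun _ _ => Nat.zero_le _) (show 1 ∈ Finset.Ico 1 (Nat.log p N + 2) by simp)
  simpa using this

/-- Combine `log n ≤ 2 √n` with `n (n - 1) ≥ n² / 2`; the bound serves only to dominate by a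
convergent series. -/
theorem Real.log_div_mul_pred_le_rpow {n : ℕ} (hn : 2 ≤ n) :
    Real.log n / (n * (n - 1)) ≤ 4 * ((n : ℝ) ^ (3 / 2 : ℝ))⁻¹ := by
  have h2 : (2 : ℝ) ≤ n := by exact_mod_cast hn
  have h0 : (0 : ℝ) < n := by linarith
  have h1 := Real.log_le_rpow_div h0.le (ε := 1 / 2) (by norm_num)
  have h3 : (n : ℝ) ^ (3 / 2 : ℝ) * (n : ℝ) ^ (1 / 2 : ℝ) = n * n := by
    rw [← Real.rpow_add h0]; norm_num; ring
  have h4 : 0 < (n : ℝ) ^ (3 / 2 : ℝ) := by positivity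
  have h5 : 0 < (n : ℝ) ^ (1 / 2 : ℝ) := by positivity
  rw [← div_eq_mul_inv, div_le_div_iff₀ (by nlinarith) h4]
  have : Real.log n ≤ 2 * (n : ℝ) ^ (1 / 2 : ℝ) := by linarith
  nlinarith

theorem Nat.cast_factorization_factorial_le_div_pred {p N : ℕ} (hp : p.Prime) :
    (N.factorial.factorization p : ℝ) ≤ N / (p - 1) := by
  have h1 : (1 : ℝ) < p := by exact_mod_cast hp.one_lt
  have : Fact p.Prime := ⟨hp⟩
  rw [le_div_iff₀ (by linarith)]
  have h := sub_one_mul_padicValNat_factorial (p := p) N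
  have h2 : (p - 1) * N.factorial.factorization p ≤ N := by
    rw [Nat.factorization_def _ hp, h]; omega
  have h3 : (((p - 1 : ℕ) * N.factorial.factorization p : ℕ) : ℝ) ≤ N := by exact_mod_cast h2
  rw [Nat.cast_mul, Nat.cast_sub hp.one_le, Nat.cast_one] at h3
  linarith

/-- Mertens' first theorem. -/
theorem exists_abs_sum_log_div_sub_log_le :
    ∃ C : ℝ, ∀ N : ℕ, N ≠ 0 → |∑ p ∈ N.primesLE, Real.log p / p - Real.log N| ≤ C := by
  have hs : Summable fun n : ℕ => 4 * ((n : ℝ) ^ (3 / 2 : ℝ))⁻¹ :=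
    (Real.summable_nat_rpow_inv.2 (by norm_num)).mul_left 4
  set D := ∑' n : ℕ, 4 * ((n : ℝ) ^ (3 / 2 : ℝ))⁻¹ with hD
  refine ⟨max (Real.log 4) (1 + D), fun N hN => ?_⟩
  have hN0 : (0 : ℝ) < N := by exact_mod_cast Nat.pos_of_ne_zero hN
  rw [abs_le']
  constructor
  · refine le_trans ?_ (le_max_left _ _)
    -- Replacing `⌊N/p⌋` by `N/p` costs at most `log p` per prime, in total `θ(N) ≤ N log 4`.
    have h1 : ∑ p ∈ N.primesLE, ((N : ℝ) * (Real.log p / p) - Real.log p)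
        ≤ Real.log (N.factorial : ℝ) := by
      rw [Real.log_factorial_eq_sum_primesLE]
      refine Finset.sum_le_sum fun p hp => ?_
      have hp' := Nat.prime_of_mem_primesLE hp
      have hl : 0 ≤ Real.log p := Real.log_natCast_nonneg p
      have h3 : (N : ℝ) / p - 1 ≤ (N.factorial.factorization p : ℝ) := by
        have h4 : ((N / p : ℕ) : ℝ) ≤ (N.factorial.factorization p : ℝ) := by
          exact_mod_cast Nat.div_le_factorization_factorial hp'
        have h5 := Nat.sub_one_lt_floor ((N : ℝ) / p)
        rw [Nat.floor_div_eq_div] at h5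
        linarith
      calc (N : ℝ) * (Real.log p / p) - Real.log p = (N / p - 1) * Real.log p := by ring
        _ ≤ _ := mul_le_mul_of_nonneg_right h3 hl
    rw [Finset.sum_sub_distrib, ← Finset.mul_sum, ← Chebyshev.theta_eq_sum_primesLE_log] at h1
    have h2 : Real.log (N.factorial : ℝ) ≤ N * Real.log N := by
      rw [← Real.log_pow]
      exact Real.log_le_log (by positivity) (by exact_mod_cast Nat.factorial_le_pow N)
    have h3 := Chebyshev.theta_le_log4_mul_x hN0.le
    have : (N : ℝ) * (∑ p ∈ N.primesLE, Real.log p / p) ≤ N * (Real.log N + Real.log 4) := by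
      linarith
    linarith [le_of_mul_le_mul_left this hN0]
  · refine le_trans ?_ (le_max_right _ _)
    -- Here `1/(p-1) = 1/p + 1/(p(p-1))`, and the second term, weighted by `log p`, has a bounded
    -- sum.
    have h1 : Real.log (N.factorial : ℝ)
        ≤ ∑ p ∈ N.primesLE, (N * (Real.log p / p) + N * (Real.log p / (p * (p - 1)))) := by
      rw [Real.log_factorial_eq_sum_primesLE]
      refine Finset.sum_le_sum fun p hp => ?_
      have hp' := Nat.prime_of_mem_primesLE hp
      have hp1 : (1 : ℝ) < p := by exact_mod_cast hp'.one_lt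
      have hl : 0 ≤ Real.log p := Real.log_natCast_nonneg p
      refine (mul_le_mul_of_nonneg_right
        (Nat.cast_factorization_factorial_le_div_pred hp') hl).trans_eq ?_
      have : (p : ℝ) - 1 ≠ 0 := by linarith
      field_simp
      ring
    rw [Finset.sum_add_distrib, ← Finset.mul_sum, ← Finset.mul_sum] at h1
    have h2 : ∑ p ∈ N.primesLE, Real.log p / (p * (p - 1)) ≤ D :=
      (Finset.sum_le_sum fun p hp =>
        Real.log_div_mul_pred_le_rpow (Nat.two_le_of_mem_primesLE hp)).trans
        (hs.sum_le_tsum _ fun _ _ => by positivity)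
    have h3 := Stirling.le_log_factorial_stirling hN
    have h4 : 0 ≤ Real.log (2 * Real.pi) := Real.log_nonneg (by linarith [Real.pi_gt_three])
    have h5 : 0 ≤ Real.log N := Real.log_natCast_nonneg N
    have : (N : ℝ) * (Real.log N - 1) ≤ N * (∑ p ∈ N.primesLE, Real.log p / p + D) := by
      nlinarith [mul_le_mul_of_nonneg_left h2 hN0.le]
    linarith [le_of_mul_le_mul_left this hN0]

/-! ### Prime reciprocals in logarithmic blocks. -/

/-- The sum of the reciprocals of the primes up to `N`. -/
noncomputable def sumPrimesInv (N : ℕ) : ℝ := ∑ p ∈ N.primesLE, (p : ℝ)⁻¹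

/-- The primes `p` with `m < log p ≤ m + 1`. -/
noncomputable def primeBlock (m : ℕ) : Finset ℕ :=
  ⌊Real.exp ((m + 1 : ℕ) : ℝ)⌋₊.primesLE \ ⌊Real.exp (m : ℝ)⌋₊.primesLE

theorem sum_primeBlock_eq_sub (f : ℕ → ℝ) (m : ℕ) :
    ∑ p ∈ primeBlock m, f p = ∑ p ∈ ⌊Real.exp ((m + 1 : ℕ) : ℝ)⌋₊.primesLE, f p
      - ∑ p ∈ ⌊Real.exp (m : ℝ)⌋₊.primesLE, f p := by
  rw [primeBlock, Finset.sum_sdiff_eq_sub]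
  refine Nat.primesLE_mono (Nat.floor_le_floor (Real.exp_le_exp.2 ?_))
  push_cast; linarith

theorem sum_range_sum_primeBlock (f : ℕ → ℝ) (M : ℕ) :
    ∑ m ∈ Finset.range M, ∑ p ∈ primeBlock m, f p
      = ∑ p ∈ ⌊Real.exp (M : ℝ)⌋₊.primesLE, f p := by
  simp_rw [sum_primeBlock_eq_sub]
  rw [Finset.sum_range_sub (fun m : ℕ => ∑ p ∈ ⌊Real.exp (m : ℝ)⌋₊.primesLE, f p)]
  simp

theorem prime_and_log_mem_of_mem_primeBlock {m p : ℕ} (hp : p ∈ primeBlock m) :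
    p.Prime ∧ (m : ℝ) < Real.log p ∧ Real.log p ≤ m + 1 := by
  rw [primeBlock, Finset.mem_sdiff, Nat.mem_primesLE, Nat.mem_primesLE] at hp
  obtain ⟨⟨h1, h2⟩, h3⟩ := hp
  have h0 : (0 : ℝ) < p := by exact_mod_cast h2.pos
  refine ⟨h2, ?_, ?_⟩
  · rw [Real.lt_log_iff_exp_lt h0]
    by_contra! h
    exact h3 ⟨Nat.le_floor h, h2⟩
  · rw [Real.log_le_iff_le_exp h0]
    have := (Nat.le_floor_iff (Real.exp_pos _).le).1 h1
    push_cast at this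
    exact this

theorem abs_log_floor_exp_sub_le (M : ℕ) :
    |Real.log (⌊Real.exp (M : ℝ)⌋₊ : ℝ) - M| ≤ 1 := by
  have h1 : (1 : ℝ) ≤ Real.exp M := Real.one_le_exp (Nat.cast_nonneg M)
  have h2 := Nat.floor_le (zero_le_one.trans h1)
  have h3 := Nat.lt_floor_add_one (Real.exp (M : ℝ))
  have h4 : (1 : ℝ) ≤ ⌊Real.exp (M : ℝ)⌋₊ := by
    exact_mod_cast Nat.le_floor (by exact_mod_cast h1)
  have h5 : Real.log (⌊Real.exp (M : ℝ)⌋₊ : ℝ) ≤ M := by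
    rw [Real.log_le_iff_le_exp (by linarith)]; exact h2
  have h6 : (M : ℝ) - 1 ≤ Real.log (⌊Real.exp (M : ℝ)⌋₊ : ℝ) := by
    rw [Real.le_log_iff_exp_le (by linarith), Real.exp_sub, div_le_iff₀ (Real.exp_pos _)]
    -- Since `e ≥ 2` and the floor is at least 1, `exp M < floor + 1 ≤ 2 * floor ≤ e * floor`.
    have := Real.add_one_le_exp 1
    nlinarith
  rw [abs_le]; constructor <;> linarith

theorem exists_norm_sum_primeBlock_log_div_sub_one_le :
    ∃ C : ℝ, ∀ M : ℕ,
      ‖∑ m ∈ Finset.range M, (∑ p ∈ primeBlock m, Real.log p / p - 1)‖ ≤ C := by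
  obtain ⟨C, hC⟩ := exists_abs_sum_log_div_sub_log_le
  refine ⟨C + 1, fun M => ?_⟩
  rw [Finset.sum_sub_distrib, sum_range_sum_primeBlock]
  simp only [Finset.sum_const, Finset.card_range, nsmul_eq_mul, mul_one, Real.norm_eq_abs]
  have h1 := hC ⌊Real.exp (M : ℝ)⌋₊
    (Nat.floor_pos.2 (Real.one_le_exp (Nat.cast_nonneg M))).ne'
  have h2 := abs_log_floor_exp_sub_le M
  rw [abs_le] at *
  constructor <;> linarith

theorem exists_sum_primeBlock_log_div_le :
    ∃ K : ℝ, ∀ m : ℕ, ∑ p ∈ primeBlock m, Real.log p / p ≤ K := by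
  obtain ⟨C, hC⟩ := exists_norm_sum_primeBlock_log_div_sub_one_le
  refine ⟨2 * C + 1, fun m => ?_⟩
  have h1 := hC m
  have h2 := hC (m + 1)
  rw [Finset.sum_range_succ] at h2
  rw [Real.norm_eq_abs, abs_le] at h1 h2
  linarith

/-- In a block `log p` differs from `m + 1` by less than 1, so `1/p` may be traded for `log p /
((m+1) p)`. The factor 2 comes from `m + 1 ≤ 2m < 2 log p`, which needs `m ≥ 1`. -/
theorem abs_sum_primeBlock_inv_sub_le {m : ℕ} (hm : 1 ≤ m) :
    |∑ p ∈ primeBlock m, (p : ℝ)⁻¹ - ((m : ℝ) + 1)⁻¹ * ∑ p ∈ primeBlock m, Real.log p / p|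
      ≤ 2 * ((m : ℝ) + 1)⁻¹ ^ 2 * ∑ p ∈ primeBlock m, Real.log p / p := by
  have hm1 : (1 : ℝ) ≤ m := by exact_mod_cast hm
  rw [Finset.mul_sum, Finset.mul_sum, ← Finset.sum_sub_distrib]
  refine (Finset.abs_sum_le_sum_abs _ _).trans (Finset.sum_le_sum fun p hp => ?_)
  obtain ⟨hp, h1, h2⟩ := prime_and_log_mem_of_mem_primeBlock hp
  have h0 : (0 : ℝ) < p := by exact_mod_cast hp.pos
  have e1 : (p : ℝ)⁻¹ - ((m : ℝ) + 1)⁻¹ * (Real.log p / p)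
      = (p : ℝ)⁻¹ * ((m : ℝ) + 1)⁻¹ * (m + 1 - Real.log p) := by
    field_simp
  have e2 : 2 * ((m : ℝ) + 1)⁻¹ ^ 2 * (Real.log p / p)
      = (p : ℝ)⁻¹ * ((m : ℝ) + 1)⁻¹ * (2 * ((m : ℝ) + 1)⁻¹ * Real.log p) := by
    field_simp
  rw [e1, e2, abs_of_nonneg (mul_nonneg (by positivity) (by linarith))]
  refine mul_le_mul_of_nonneg_left ?_ (by positivity)
  have : 1 ≤ 2 * ((m : ℝ) + 1)⁻¹ * Real.log p := by
    rw [mul_assoc, inv_mul_eq_div, mul_div_assoc', le_div_iff₀ (by linarith)]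
    linarith
  linarith

/-- Dirichlet's test: by Mertens' first theorem the block sums of `log p / p`, less 1, have bounded
partial sums, and the weights `1/(m+1)` decrease to 0. The error of passing to `1/p` is summable. -/
theorem exists_tendsto_sum_range_primeBlock_inv_sub_inv :
    ∃ l : ℝ, Tendsto (fun M : ℕ => ∑ m ∈ Finset.range M,
      (∑ p ∈ primeBlock m, (p : ℝ)⁻¹ - ((m : ℝ) + 1)⁻¹)) atTop (𝓝 l) := by
  obtain ⟨C, hC⟩ := exists_norm_sum_primeBlock_log_div_sub_one_le
  obtain ⟨K, hK⟩ := exists_sum_primeBlock_log_div_le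
  have hanti : Antitone fun m : ℕ => ((m : ℝ) + 1)⁻¹ := fun a b h => by
    have : (a : ℝ) ≤ b := by exact_mod_cast h
    dsimp only
    gcongr
  have h0 : Tendsto (fun m : ℕ => ((m : ℝ) + 1)⁻¹) atTop (𝓝 0) := by
    simpa [one_div] using tendsto_one_div_add_atTop_nhds_zero_nat (𝕜 := ℝ)
  obtain ⟨l₁, hl₁⟩ := cauchySeq_tendsto_of_complete
    (hanti.cauchySeq_series_mul_of_tendsto_zero_of_bounded h0 hC)
  have hs : Summable fun m : ℕ => ∑ p ∈ primeBlock m, (p : ℝ)⁻¹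
      - ((m : ℝ) + 1)⁻¹ * ∑ p ∈ primeBlock m, Real.log p / p := by
    have hb : Summable fun m : ℕ => 2 * ((m : ℝ) + 1)⁻¹ ^ 2 * K := by
      have := (summable_nat_add_iff 1).2 (Real.summable_nat_pow_inv (p := 2).2 (by norm_num))
      refine Summable.mul_right _ (Summable.mul_left _ ?_)
      simpa using this
    refine Summable.of_norm_bounded_eventually_nat hb ?_
    filter_upwards [eventually_ge_atTop 1] with m hm
    exact (abs_sum_primeBlock_inv_sub_le hm).trans
      (mul_le_mul_of_nonneg_left (hK m) (by positivity))
  refine ⟨_, (hs.hasSum.tendsto_sum_nat.add hl₁).congr fun M => ?_⟩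
  rw [← Finset.sum_add_distrib]
  refine Finset.sum_congr rfl fun m _ => ?_
  rw [smul_eq_mul]; ring

/-! ### The sum of `p^(-s)` as `s` decreases to 1, from the Euler product. -/

/-- The difference between `-log (1 - u)` and its linear approximation. -/
noncomputable def logTail (u : ℝ) : ℝ := -Real.log (1 - u) - u

theorem logTail_nonneg {u : ℝ} (h : u ≤ 1 / 2) : 0 ≤ logTail u := by
  have := Real.log_le_sub_one_of_pos (show 0 < 1 - u by linarith)
  unfold logTail; linarith

theorem logTail_le {u : ℝ} (h : u ≤ 1 / 2) : logTail u ≤ 2 * u ^ 2 := by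
  have h0 : 0 < 1 - u := by linarith
  have h1 := Real.one_sub_inv_le_log_of_pos h0
  have h2 : (1 - u)⁻¹ ≤ 1 + u + 2 * u ^ 2 := by
    rw [inv_le_iff_one_le_mul₀ h0]
    nlinarith [sq_nonneg u, mul_nonneg (sq_nonneg u) (show 0 ≤ 1 - 2 * u by linarith)]
  unfold logTail; linarith

theorem continuousAt_logTail {u : ℝ} (h : u < 1) : ContinuousAt logTail u := by
  unfold logTail
  exact (((continuousAt_const.sub continuousAt_id).log (by simp; linarith)).neg).sub
    continuousAt_id

theorem Nat.Primes.rpow_neg_le_inv (p : Nat.Primes) {s : ℝ} (hs : 1 ≤ s) :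
    (p : ℝ) ^ (-s) ≤ (p : ℝ)⁻¹ := by
  have h1 : (1 : ℝ) ≤ p := by exact_mod_cast p.2.one_le
  rw [← Real.rpow_neg_one]
  exact Real.rpow_le_rpow_of_exponent_le h1 (by linarith)

theorem Nat.Primes.inv_le_half (p : Nat.Primes) : (p : ℝ)⁻¹ ≤ 1 / 2 := by
  have h1 : (2 : ℝ) ≤ p := by exact_mod_cast p.2.two_le
  rw [one_div]; gcongr

theorem Nat.Primes.rpow_neg_le_half (p : Nat.Primes) {s : ℝ} (hs : 1 ≤ s) :
    (p : ℝ) ^ (-s) ≤ 1 / 2 := (p.rpow_neg_le_inv hs).trans p.inv_le_half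

theorem Nat.Primes.summable_two_mul_inv_sq :
    Summable fun p : Nat.Primes => 2 * ((p : ℝ)⁻¹) ^ 2 := by
  have := (Nat.Primes.summable_rpow (r := -2)).2 (by norm_num)
  refine (this.mul_left 2).congr fun p => ?_
  rw [Real.rpow_neg (by positivity)]
  norm_num

theorem Nat.Primes.logTail_rpow_neg_mem (p : Nat.Primes) {s : ℝ} (hs : 1 ≤ s) :
    0 ≤ logTail ((p : ℝ) ^ (-s)) ∧ logTail ((p : ℝ) ^ (-s)) ≤ 2 * ((p : ℝ)⁻¹) ^ 2 := by
  refine ⟨logTail_nonneg (p.rpow_neg_le_half hs), (logTail_le (p.rpow_neg_le_half hs)).trans ?_⟩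
  have := p.rpow_neg_le_inv hs
  gcongr

theorem Nat.Primes.summable_logTail_rpow_neg {s : ℝ} (hs : 1 ≤ s) :
    Summable fun p : Nat.Primes => logTail ((p : ℝ) ^ (-s)) :=
  Nat.Primes.summable_two_mul_inv_sq.of_nonneg_of_le
    (fun p => (p.logTail_rpow_neg_mem hs).1) fun p => (p.logTail_rpow_neg_mem hs).2

theorem riemannZeta_ofReal_eq_exp {s : ℝ} (hs : 1 < s) :
    riemannZeta (s : ℂ) = ((Real.exp (∑' p : Nat.Primes, (p : ℝ) ^ (-s)
      + ∑' p : Nat.Primes, logTail ((p : ℝ) ^ (-s))) : ℝ) : ℂ) := by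
  have h1 : Summable fun p : Nat.Primes => (p : ℝ) ^ (-s) :=
    Nat.Primes.summable_rpow.2 (by linarith)
  have h2 := Nat.Primes.summable_logTail_rpow_neg hs.le
  have h3 := ((h1.hasSum.add h2.hasSum).rexp).map Complex.ofRealHom Complex.continuous_ofReal
  refine (riemannZeta_eulerProduct_hasProd (by simpa using hs)).unique ?_
  convert! h3 using 1
  funext p
  have h4 := p.rpow_neg_le_half hs.le
  simp only [Function.comp_apply, logTail, Complex.ofRealHom_eq_coe]
  rw [show (p : ℝ) ^ (-s) + (-Real.log (1 - (p : ℝ) ^ (-s)) - (p : ℝ) ^ (-s))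
    = -Real.log (1 - (p : ℝ) ^ (-s)) by ring, Real.exp_neg, Real.exp_log (by linarith)]
  push_cast
  rw [Complex.ofReal_cpow (by positivity)]
  simp

/-- Take logarithms in `δ ζ(1+δ) → 1`. The part of `log ζ` beyond the linear terms converges by
domination by `2/p²`. -/
theorem tendsto_tsum_primes_rpow_add_log :
    Tendsto (fun δ : ℝ => ∑' p : Nat.Primes, (p : ℝ) ^ (-(1 + δ)) + Real.log δ) (𝓝[>] 0)
      (𝓝 (-∑' p : Nat.Primes, logTail (p : ℝ)⁻¹)) := by
  have hpos : ∀ᶠ δ : ℝ in 𝓝[>] 0, 0 < δ := eventually_mem_nhdsWithin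
  have hG : Tendsto (fun δ : ℝ => ∑' p : Nat.Primes, logTail ((p : ℝ) ^ (-(1 + δ)))) (𝓝[>] 0)
      (𝓝 (∑' p : Nat.Primes, logTail (p : ℝ)⁻¹)) := by
    refine tendsto_tsum_of_dominated_convergence Nat.Primes.summable_two_mul_inv_sq
      (fun p => ?_) ?_
    · have hp : (0 : ℝ) < p := by exact_mod_cast p.2.pos
      refine Tendsto.mono_left ?_ nhdsWithin_le_nhds
      refine (continuousAt_logTail (u := (p : ℝ)⁻¹)
        (by linarith [p.inv_le_half])).tendsto.comp ?_
      have hc : Continuous fun δ : ℝ => (p : ℝ) ^ (-(1 + δ)) :=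
        continuous_const.rpow (by fun_prop) fun _ => Or.inl hp.ne'
      have := hc.tendsto 0
      simpa [Real.rpow_neg_one] using this
    · filter_upwards [hpos] with δ hδ p
      have := p.logTail_rpow_neg_mem (s := 1 + δ) (by linarith)
      rw [Real.norm_eq_abs, abs_of_nonneg this.1]
      exact this.2
  have hz : Tendsto (fun δ : ℝ => ∑' p : Nat.Primes, (p : ℝ) ^ (-(1 + δ))
      + ∑' p : Nat.Primes, logTail ((p : ℝ) ^ (-(1 + δ))) + Real.log δ) (𝓝[>] 0) (𝓝 0) := by
    have h1 : Tendsto (fun δ : ℝ => ((1 + δ : ℝ) : ℂ)) (𝓝[>] 0) (𝓝[≠] 1) := by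
      refine tendsto_nhdsWithin_iff.2 ⟨?_, ?_⟩
      · have : Continuous fun δ : ℝ => ((1 + δ : ℝ) : ℂ) := by fun_prop
        simpa using (this.tendsto 0).mono_left nhdsWithin_le_nhds
      · filter_upwards [hpos] with δ hδ
        simp only [Set.mem_compl_iff, Set.mem_singleton_iff]
        norm_cast
        simp [hδ.ne']
    have h2 := (Complex.continuous_re.tendsto _).comp (riemannZeta_residue_one.comp h1)
    have h3 := (Real.continuousAt_log (x := 1) one_ne_zero).tendsto.comp h2
    rw [Real.log_one] at h3
    refine h3.congr' ?_
    filter_upwards [hpos] with δ hδ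
    simp only [Function.comp_apply]
    rw [riemannZeta_ofReal_eq_exp (by linarith)]
    have : (((1 + δ : ℝ) : ℂ) - 1) = (δ : ℂ) := by push_cast; ring
    rw [this, ← Complex.ofReal_mul, Complex.ofReal_re, Real.log_mul hδ.ne' (Real.exp_ne_zero _),
      Real.log_exp]
    ring
  have := hz.sub hG
  rw [zero_sub] at this
  refine this.congr fun δ => ?_
  ring

/-! ### Comparison of the prime sum with a power series in `exp (-δ)`. -/

theorem tendsto_sum_primeBlock_rpow {s : ℝ} (hs : 1 < s) :
    Tendsto (fun M : ℕ => ∑ m ∈ Finset.range M, ∑ p ∈ primeBlock m, (p : ℝ) ^ (-s)) atTop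
      (𝓝 (∑' p : Nat.Primes, (p : ℝ) ^ (-s))) := by
  have h1 : Summable fun p : Nat.Primes => (p : ℝ) ^ (-s) :=
    Nat.Primes.summable_rpow.2 (by linarith)
  have h2 := ((Nat.Primes.hasSum_iff_hasSum_ite (fun n : ℕ => (n : ℝ) ^ (-s))).1
    h1.hasSum).tendsto_sum_nat
  have h3 : Tendsto (fun M : ℕ => ⌊Real.exp (M : ℝ)⌋₊ + 1) atTop atTop :=
    (tendsto_add_atTop_nat 1).comp (tendsto_nat_floor_atTop.comp
      (Real.tendsto_exp_atTop.comp tendsto_natCast_atTop_atTop))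
  refine (h2.comp h3).congr fun M => ?_
  rw [sum_range_sum_primeBlock, Function.comp_apply, Nat.primesLE_eq_filter_range,
    Finset.sum_filter]

theorem sum_primeBlock_rpow_bounds {δ : ℝ} (hδ : 0 < δ) (m : ℕ) :
    Real.exp (-δ) * ((∑ p ∈ primeBlock m, (p : ℝ)⁻¹) * Real.exp (-δ) ^ m)
        ≤ ∑ p ∈ primeBlock m, (p : ℝ) ^ (-(1 + δ)) ∧
      ∑ p ∈ primeBlock m, (p : ℝ) ^ (-(1 + δ))
        ≤ (∑ p ∈ primeBlock m, (p : ℝ)⁻¹) * Real.exp (-δ) ^ m := by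
  have key : ∀ p ∈ primeBlock m, (p : ℝ) ^ (-(1 + δ)) = (p : ℝ)⁻¹ * Real.exp (-δ * Real.log p) := by
    intro p hp
    have h0 : (0 : ℝ) < p := by
      exact_mod_cast (prime_and_log_mem_of_mem_primeBlock hp).1.pos
    rw [neg_add, Real.rpow_add h0, Real.rpow_neg_one, Real.rpow_def_of_pos h0 (-δ), mul_comm (-δ)]
  rw [Finset.sum_mul, Finset.mul_sum, Finset.sum_congr rfl key]
  constructor
  · refine Finset.sum_le_sum fun p hp => ?_
    obtain ⟨hp, h1, h2⟩ := prime_and_log_mem_of_mem_primeBlock hp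
    rw [mul_left_comm, ← Real.exp_nat_mul, ← Real.exp_add]
    refine mul_le_mul_of_nonneg_left (Real.exp_le_exp.2 ?_) (by positivity)
    nlinarith
  · refine Finset.sum_le_sum fun p hp => ?_
    obtain ⟨hp, h1, h2⟩ := prime_and_log_mem_of_mem_primeBlock hp
    rw [← Real.exp_nat_mul]
    refine mul_le_mul_of_nonneg_left (Real.exp_le_exp.2 ?_) (by positivity)
    nlinarith

theorem summable_primeBlock_inv_mul_pow {δ : ℝ} (hδ : 0 < δ) :
    Summable fun m : ℕ => (∑ p ∈ primeBlock m, (p : ℝ)⁻¹) * Real.exp (-δ) ^ m := by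
  have hs : 1 < 1 + δ := by linarith
  have hz : ∀ m, 0 ≤ ∑ p ∈ primeBlock m, (p : ℝ) ^ (-(1 + δ)) := fun m =>
    Finset.sum_nonneg fun p _ => by positivity
  have hmono : Monotone fun M : ℕ => ∑ m ∈ Finset.range M, ∑ p ∈ primeBlock m,
      (p : ℝ) ^ (-(1 + δ)) :=
    monotone_nat_of_le_succ fun M => by rw [Finset.sum_range_succ]; linarith [hz M]
  refine summable_of_sum_range_le (c := (Real.exp (-δ))⁻¹ *
    ∑' p : Nat.Primes, (p : ℝ) ^ (-(1 + δ))) (fun m => by positivity) fun M => ?_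
  rw [le_inv_mul_iff₀ (Real.exp_pos _), Finset.mul_sum]
  exact (Finset.sum_le_sum fun m _ => (sum_primeBlock_rpow_bounds hδ m).1).trans
    (hmono.ge_of_tendsto (tendsto_sum_primeBlock_rpow hs) M)

theorem tsum_primeBlock_inv_mul_pow_bounds {δ : ℝ} (hδ : 0 < δ) :
    Real.exp (-δ) * ∑' m : ℕ, (∑ p ∈ primeBlock m, (p : ℝ)⁻¹) * Real.exp (-δ) ^ m
        ≤ ∑' p : Nat.Primes, (p : ℝ) ^ (-(1 + δ)) ∧
      ∑' p : Nat.Primes, (p : ℝ) ^ (-(1 + δ))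
        ≤ ∑' m : ℕ, (∑ p ∈ primeBlock m, (p : ℝ)⁻¹) * Real.exp (-δ) ^ m := by
  have hQ := (summable_primeBlock_inv_mul_pow hδ).hasSum.tendsto_sum_nat
  have hZ := tendsto_sum_primeBlock_rpow (show 1 < 1 + δ by linarith)
  constructor
  · refine le_of_tendsto_of_tendsto' (hQ.const_mul (Real.exp (-δ))) hZ fun M => ?_
    rw [Finset.mul_sum]
    exact Finset.sum_le_sum fun m _ => (sum_primeBlock_rpow_bounds hδ m).1
  · exact le_of_tendsto_of_tendsto' hZ hQ fun M =>
      Finset.sum_le_sum fun m _ => (sum_primeBlock_rpow_bounds hδ m).2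

theorem tendsto_exp_neg_nhdsGT_zero :
    Tendsto (fun δ : ℝ => Real.exp (-δ)) (𝓝[>] 0) (𝓝 1) := by
  have hc : Continuous fun δ : ℝ => Real.exp (-δ) := by fun_prop
  simpa using (hc.tendsto 0).mono_left nhdsWithin_le_nhds

theorem tendsto_one_sub_exp_neg_div :
    Tendsto (fun δ : ℝ => (1 - Real.exp (-δ)) / δ) (𝓝[>] 0) (𝓝 1) := by
  have h : HasDerivAt (fun δ : ℝ => 1 - Real.exp (-δ)) 1 0 := by
    simpa using ((Real.hasDerivAt_exp (-0)).comp (0 : ℝ) (hasDerivAt_neg 0)).const_sub 1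
  have := (hasDerivAt_iff_tendsto_slope_zero.1 h).mono_left
    (nhdsWithin_mono 0 fun x (hx : 0 < x) => hx.ne')
  refine this.congr fun δ => ?_
  simp [div_eq_inv_mul]

theorem tendsto_mul_log_nhdsGT_zero :
    Tendsto (fun δ : ℝ => δ * Real.log δ) (𝓝[>] 0) (𝓝 0) := by
  have := Real.continuous_mul_log.tendsto 0
  simpa using this.mono_left nhdsWithin_le_nhds

/-- The generating function of the blocks of prime reciprocals, near the boundary. -/
theorem tendsto_tsum_primeBlock_add_log :
    Tendsto (fun δ : ℝ => ∑' m : ℕ, (∑ p ∈ primeBlock m, (p : ℝ)⁻¹) * Real.exp (-δ) ^ m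
      + Real.log δ) (𝓝[>] 0) (𝓝 (-∑' p : Nat.Primes, logTail (p : ℝ)⁻¹)) := by
  have hpos : ∀ᶠ δ : ℝ in 𝓝[>] 0, 0 < δ := eventually_mem_nhdsWithin
  have hZ := tendsto_tsum_primes_rpow_add_log
  have hid : Tendsto (fun δ : ℝ => δ) (𝓝[>] 0) (𝓝 0) :=
    tendsto_id.mono_left nhdsWithin_le_nhds
  have he := tendsto_exp_neg_nhdsGT_zero
  -- The gap between the two bounds is of order `δ` times the prime sum, which grows only like `-log
  -- δ`.
  have hsmall : Tendsto (fun δ : ℝ => (1 - Real.exp (-δ)) *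
      ∑' p : Nat.Primes, (p : ℝ) ^ (-(1 + δ)) / Real.exp (-δ)) (𝓝[>] 0) (𝓝 0) := by
    have h1 := ((hid.mul hZ).sub tendsto_mul_log_nhdsGT_zero)
    have h2 := (tendsto_one_sub_exp_neg_div.mul h1).div he one_ne_zero
    simp only [zero_mul, sub_zero, mul_zero, zero_div] at h2
    refine h2.congr' ?_
    filter_upwards [hpos] with δ hδ
    simp only [Pi.div_apply]
    rw [tsum_div_const]
    field_simp
    ring
  have hupper := hZ.add hsmall
  rw [add_zero] at hupper
  refine tendsto_of_tendsto_of_tendsto_of_le_of_le' hZ hupper ?_ ?_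
  · filter_upwards [hpos] with δ hδ
    linarith [(tsum_primeBlock_inv_mul_pow_bounds hδ).2]
  · filter_upwards [hpos] with δ hδ
    have h := (tsum_primeBlock_inv_mul_pow_bounds hδ).1
    rw [← le_div_iff₀' (Real.exp_pos _)] at h
    rw [tsum_div_const]
    have : ∀ Z : ℝ, Z + Real.log δ + (1 - Real.exp (-δ)) * (Z / Real.exp (-δ))
      = Z / Real.exp (-δ) + Real.log δ := fun Z => by field_simp; ring
    rw [this]
    linarith

theorem hasSum_inv_mul_pow {x : ℝ} (hx0 : 0 < x) (hx1 : x < 1) :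
    HasSum (fun m : ℕ => ((m : ℝ) + 1)⁻¹ * x ^ m) (-Real.log (1 - x) / x) := by
  have := (Real.hasSum_pow_div_log_of_abs_lt_one (abs_lt.2 ⟨by linarith, hx1⟩)).div_const x
  refine this.congr_fun ?_
  intro m
  field_simp
  ring

theorem tendsto_log_one_sub_exp_neg_div_sub_log :
    Tendsto (fun δ : ℝ => Real.log (1 - Real.exp (-δ)) / Real.exp (-δ) - Real.log δ) (𝓝[>] 0)
      (𝓝 0) := by
  have hpos : ∀ᶠ δ : ℝ in 𝓝[>] 0, 0 < δ := eventually_mem_nhdsWithin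
  have he := tendsto_exp_neg_nhdsGT_zero
  have h1 := (Real.continuousAt_log (x := 1) one_ne_zero).tendsto.comp tendsto_one_sub_exp_neg_div
  rw [Real.log_one] at h1
  have h2 := ((h1.add (tendsto_one_sub_exp_neg_div.mul tendsto_mul_log_nhdsGT_zero)).div he
    one_ne_zero)
  simp only [mul_zero, add_zero, zero_div] at h2
  refine h2.congr' ?_
  filter_upwards [hpos] with δ hδ
  have h3 : Real.exp (-δ) < 1 := by rw [Real.exp_lt_one_iff]; linarith
  simp only [Pi.div_apply, Function.comp_apply]
  rw [Real.log_div (by linarith) hδ.ne']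
  field_simp
  ring

/-! ### Mertens' second and third theorems with their constants. -/

/-- The limit exists by Dirichlet's test, so Abel's theorem lets it be computed as the boundary
value of the power series. -/
theorem tendsto_sumPrimesInv_exp_sub_harmonic :
    Tendsto (fun M : ℕ => sumPrimesInv ⌊Real.exp (M : ℝ)⌋₊ - harmonic M) atTop
      (𝓝 (-∑' p : Nat.Primes, logTail (p : ℝ)⁻¹)) := by
  obtain ⟨l, hl⟩ := exists_tendsto_sum_range_primeBlock_inv_sub_inv
  have hpos : ∀ᶠ δ : ℝ in 𝓝[>] 0, 0 < δ := eventually_mem_nhdsWithin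
  have he : Tendsto (fun δ : ℝ => Real.exp (-δ)) (𝓝[>] 0) (𝓝[<] 1) := by
    refine tendsto_nhdsWithin_iff.2 ⟨tendsto_exp_neg_nhdsGT_zero, ?_⟩
    filter_upwards [hpos] with δ hδ
    simpa using hδ
  have h1 := (Real.tendsto_tsum_powerSeries_nhdsWithin_lt hl).comp he
  have h2 := h1.sub (tendsto_tsum_primeBlock_add_log.add tendsto_log_one_sub_exp_neg_div_sub_log)
  -- The function in `h2` vanishes identically for `δ > 0`: both the logarithms of `δ` and those of
  -- `1 - exp (-δ)` cancel.
  have h3 : l - (-∑' p : Nat.Primes, logTail (p : ℝ)⁻¹ + 0) = 0 := by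
    refine tendsto_nhds_unique h2 (tendsto_const_nhds.congr' ?_)
    filter_upwards [hpos] with δ hδ
    have hx1 : Real.exp (-δ) < 1 := by rw [Real.exp_lt_one_iff]; linarith
    have h4 := hasSum_inv_mul_pow (Real.exp_pos (-δ)) hx1
    have h5 := ((summable_primeBlock_inv_mul_pow hδ).hasSum.sub h4).tsum_eq
    simp only [Function.comp_apply, sub_mul]
    rw [h5]
    ring
  have h6 : l = -∑' p : Nat.Primes, logTail (p : ℝ)⁻¹ := by linarith
  rw [← h6]
  refine hl.congr fun M => ?_
  rw [Finset.sum_sub_distrib, sum_range_sum_primeBlock, sumPrimesInv]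
  congr 1
  simp [harmonic]

theorem sumPrimesInv_mono : Monotone sumPrimesInv := fun _ _ h =>
  Finset.sum_le_sum_of_subset_of_nonneg (Nat.primesLE_mono h) fun _ _ _ => by positivity

/-- Mertens' second theorem. -/
theorem tendsto_sumPrimesInv_sub_log_log :
    Tendsto (fun x : ℝ => sumPrimesInv ⌊x⌋₊ - Real.log (Real.log x)) atTop
      (𝓝 (Real.eulerMascheroniConstant - ∑' p : Nat.Primes, logTail (p : ℝ)⁻¹)) := by
  have h0 : Tendsto (fun M : ℕ => Real.log ((M : ℝ) + 1) - Real.log M) atTop (𝓝 0) := by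
    have := (Real.tendsto_harmonic_sub_log).sub Real.tendsto_harmonic_sub_log_add_one
    rw [sub_self] at this
    refine this.congr fun M => ?_
    ring
  have h1 : Tendsto (fun M : ℕ => sumPrimesInv ⌊Real.exp (M : ℝ)⌋₊ - Real.log M) atTop
      (𝓝 (Real.eulerMascheroniConstant - ∑' p : Nat.Primes, logTail (p : ℝ)⁻¹)) := by
    have := Real.tendsto_harmonic_sub_log.add tendsto_sumPrimesInv_exp_sub_harmonic
    rw [← sub_eq_add_neg] at this
    refine this.congr fun M => ?_
    ring
  have hlow := h1.sub h0
  have hupp := (h1.comp (tendsto_add_atTop_nat 1)).add h0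
  rw [sub_zero] at hlow
  rw [add_zero] at hupp
  have hfl : Tendsto (fun x : ℝ => ⌊Real.log x⌋₊) atTop atTop :=
    tendsto_nat_floor_atTop.comp Real.tendsto_log_atTop
  refine tendsto_of_tendsto_of_tendsto_of_le_of_le' (hlow.comp hfl) (hupp.comp hfl) ?_ ?_
  · filter_upwards [eventually_ge_atTop (Real.exp 1)] with x hx
    have hx0 : 0 < x := (Real.exp_pos 1).trans_le hx
    have hl : 1 ≤ Real.log x := by rwa [Real.le_log_iff_exp_le hx0]
    have h2 := Nat.floor_le (zero_le_one.trans hl)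
    have h3 := (Nat.lt_floor_add_one (Real.log x)).le
    have h4 : sumPrimesInv ⌊Real.exp (⌊Real.log x⌋₊ : ℝ)⌋₊ ≤ sumPrimesInv ⌊x⌋₊ :=
      sumPrimesInv_mono (Nat.floor_le_floor ((Real.le_log_iff_exp_le hx0).1 h2))
    have h5 := Real.log_le_log (by linarith) h3
    simp only [Function.comp_apply]
    linarith
  · filter_upwards [eventually_ge_atTop (Real.exp 1)] with x hx
    have hx0 : 0 < x := (Real.exp_pos 1).trans_le hx
    have hl : 1 ≤ Real.log x := by rwa [Real.le_log_iff_exp_le hx0]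
    have h2 := Nat.floor_le (zero_le_one.trans hl)
    have h3 := (Nat.lt_floor_add_one (Real.log x)).le
    have hf : (1 : ℝ) ≤ ⌊Real.log x⌋₊ := by exact_mod_cast Nat.le_floor (by exact_mod_cast hl)
    have h4 : sumPrimesInv ⌊x⌋₊ ≤ sumPrimesInv ⌊Real.exp ((⌊Real.log x⌋₊ + 1 : ℕ) : ℝ)⌋₊ := by
      refine sumPrimesInv_mono (Nat.floor_le_floor ?_)
      push_cast
      exact (Real.log_le_iff_le_exp hx0).1 h3
    have h5 := Real.log_le_log (by linarith) h2
    simp only [Function.comp_apply]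
    push_cast at h4 ⊢
    linarith

/-- Mertens' third theorem. -/
theorem tendsto_prod_primesLE_inv_div_log :
    Tendsto (fun x : ℝ => (∏ p ∈ ⌊x⌋₊.primesLE, (1 - (p : ℝ)⁻¹)⁻¹) / Real.log x) atTop
      (𝓝 (Real.exp Real.eulerMascheroniConstant)) := by
  have hs : Summable fun p : Nat.Primes => logTail (p : ℝ)⁻¹ := by
    simpa [Real.rpow_neg_one] using Nat.Primes.summable_logTail_rpow_neg le_rfl
  have h1 := ((Nat.Primes.hasSum_iff_hasSum_ite (fun n : ℕ => logTail (n : ℝ)⁻¹)).1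
    hs.hasSum).tendsto_sum_nat
  have h2 : Tendsto (fun x : ℝ => ⌊x⌋₊ + 1) atTop atTop :=
    (tendsto_add_atTop_nat 1).comp tendsto_nat_floor_atTop
  have h3 := tendsto_sumPrimesInv_sub_log_log.add (h1.comp h2)
  rw [sub_add_cancel] at h3
  refine ((Real.continuous_exp.tendsto _).comp h3).congr' ?_
  filter_upwards [eventually_gt_atTop 1] with x hx
  have hl : 0 < Real.log x := Real.log_pos hx
  simp only [Function.comp_apply, sumPrimesInv]
  rw [← Finset.sum_filter, ← Nat.primesLE_eq_filter_range, sub_add_eq_add_sub,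
    ← Finset.sum_add_distrib, Real.exp_sub, Real.exp_log hl, Real.exp_sum]
  congr 1
  refine Finset.prod_congr rfl fun p hp => ?_
  have : (2 : ℝ) ≤ p := by exact_mod_cast Nat.two_le_of_mem_primesLE hp
  have h4 : (p : ℝ)⁻¹ ≤ 2⁻¹ := by gcongr
  rw [logTail, add_sub_cancel, Real.exp_neg, Real.exp_log (by linarith)]

/-! ### Product formulas for the two ratios. -/

theorem Nat.cast_div_totient_eq_prod (n : ℕ) (hn : n ≠ 0) :
    (n : ℝ) / (n.totient : ℝ) = ∏ p ∈ n.primeFactors, (1 - (p : ℝ)⁻¹)⁻¹ := by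
  have h : (n.totient : ℝ) = n * ∏ p ∈ n.primeFactors, (1 - (p : ℝ)⁻¹) := by
    have := congrArg (fun q : ℚ => (q : ℝ)) (Nat.totient_eq_mul_prod_factors n)
    push_cast at this
    exact this
  have hn0 : (n : ℝ) ≠ 0 := by exact_mod_cast hn
  rw [h, ← div_div, div_self hn0, one_div, Finset.prod_inv_distrib]

theorem Nat.cast_div_totient_le_self (n : ℕ) : (n : ℝ) / (n.totient : ℝ) ≤ n := by
  rcases Nat.eq_zero_or_pos n with rfl | hn
  · simp
  · exact _root_.div_le_self (Nat.cast_nonneg n) (by exact_mod_cast Nat.totient_pos.2 hn)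

theorem sigma_one_prime_pow_div {p : ℕ} (hp : p.Prime) (k : ℕ) :
    (ArithmeticFunction.sigma 1 (p ^ k) : ℝ) / (p : ℝ) ^ k
      = (1 - ((p : ℝ)⁻¹) ^ (k + 1)) * (1 - (p : ℝ)⁻¹)⁻¹ := by
  have h1 : (1 : ℝ) < p := by exact_mod_cast hp.one_lt
  have h2 : (p : ℝ) - 1 ≠ 0 := by linarith
  rw [ArithmeticFunction.sigma_one_apply_prime_pow hp]
  push_cast
  rw [geom_sum_eq h1.ne', show (1 : ℝ) - (p : ℝ)⁻¹ = (p - 1) / p by field_simp, inv_pow, pow_succ]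
  field_simp

theorem sigma_one_div_self_eq_prod (n : ℕ) (hn : n ≠ 0) :
    (ArithmeticFunction.sigma 1 n : ℝ) / n = ∏ p ∈ n.primeFactors,
      (1 - ((p : ℝ)⁻¹) ^ (n.factorization p + 1)) * (1 - (p : ℝ)⁻¹)⁻¹ := by
  have h1 := ArithmeticFunction.IsMultiplicative.multiplicative_factorization
    (ArithmeticFunction.sigma 1) ArithmeticFunction.isMultiplicative_sigma hn
  have h2 : (n : ℝ) = ∏ p ∈ n.primeFactors, (p : ℝ) ^ n.factorization p := by
    conv_lhs => rw [← Nat.prod_factorization_pow_eq_self hn]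
    rw [Finsupp.prod, Nat.support_factorization]
    push_cast
    rfl
  rw [h1, Finsupp.prod, Nat.support_factorization, Nat.cast_prod]
  conv_lhs => rw [h2]
  rw [← Finset.prod_div_distrib]
  exact Finset.prod_congr rfl fun p hp => sigma_one_prime_pow_div (Nat.prime_of_mem_primeFactors hp) _

theorem Nat.Prime.one_sub_inv_pos {p : ℕ} (hp : p.Prime) : 0 < 1 - (p : ℝ)⁻¹ := by
  have := inv_lt_one_of_one_lt₀ (show (1 : ℝ) < p by exact_mod_cast hp.one_lt)
  linarith

theorem sigma_one_div_self_le_div_totient (n : ℕ) :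
    (ArithmeticFunction.sigma 1 n : ℝ) / n ≤ n / (n.totient : ℝ) := by
  rcases eq_or_ne n 0 with rfl | hn
  · simp
  rw [sigma_one_div_self_eq_prod n hn, Nat.cast_div_totient_eq_prod n hn]
  refine Finset.prod_le_prod (fun p hp => ?_) fun p hp => ?_
  · have h := (Nat.prime_of_mem_primeFactors hp).one_sub_inv_pos
    exact mul_nonneg (sub_nonneg.2 (pow_le_one₀ (by positivity) (by linarith))) (by positivity)
  · have h := (Nat.prime_of_mem_primeFactors hp).one_sub_inv_pos
    refine mul_le_of_le_one_left (by positivity) ?_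
    have : 0 ≤ ((p : ℝ)⁻¹) ^ (n.factorization p + 1) := by positivity
    linarith

theorem sigma_one_div_self_of_squarefree {n : ℕ} (hn : Squarefree n) :
    (ArithmeticFunction.sigma 1 n : ℝ) / n = ∏ p ∈ n.primeFactors, (1 + (p : ℝ)⁻¹) := by
  rw [sigma_one_div_self_eq_prod n hn.ne_zero]
  refine Finset.prod_congr rfl fun p hp => ?_
  have hp' := Nat.prime_of_mem_primeFactors hp
  have h := hp'.one_sub_inv_pos
  have h1 : n.factorization p = 1 :=
    le_antisymm (hn.natFactorization_le_one p)
      (hp'.dvd_iff_one_le_factorization hn.ne_zero |>.1 (Nat.dvd_of_mem_primeFactors hp))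
  rw [h1, ← div_eq_mul_inv, div_eq_iff h.ne']
  ring

theorem sigma_one_prod_primes_pow_div_self {T : Finset ℕ} (hT : ∀ p ∈ T, p.Prime) (k : ℕ) :
    (ArithmeticFunction.sigma 1 ((∏ p ∈ T, p) ^ k) : ℝ) / (((∏ p ∈ T, p) ^ k : ℕ) : ℝ)
      = ∏ p ∈ T, (1 - ((p : ℝ)⁻¹) ^ (k + 1)) * (1 - (p : ℝ)⁻¹)⁻¹ := by
  rw [← Finset.prod_pow, ArithmeticFunction.isMultiplicative_sigma.map_prod, Nat.cast_prod,
    Nat.cast_prod, ← Finset.prod_div_distrib]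
  · refine Finset.prod_congr rfl fun p hp => ?_
    rw [Nat.cast_pow]
    exact sigma_one_prime_pow_div (hT p hp) k
  · intro p hp q hq hpq
    exact Nat.coprime_pow_primes _ _ (hT p hp) (hT q hq) hpq

/-! ### Upper and lower bounds for the upper limits. -/

theorem limsupOver_eq_of_tendsto {S : Set ℕ} {f u v : ℕ → ℝ} {n : ℕ → ℕ} {c : ℝ}
    (hfu : ∀ᶠ m in atTop, m ∈ S → f m ≤ u m) (hu : Tendsto u atTop (𝓝 c))
    (hn : Tendsto n atTop atTop) (hnS : ∀ᶠ N in atTop, n N ∈ S)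
    (hvf : ∀ᶠ N in atTop, v N ≤ f (n N)) (hv : Tendsto v atTop (𝓝 c)) :
    limsupOver S f = (c : EReal) := by
  have hnS' : Tendsto n atTop (atTop ⊓ 𝓟 S) := tendsto_inf.2 ⟨hn, tendsto_principal.2 hnS⟩
  have hne : (atTop ⊓ 𝓟 S).NeBot := hnS'.neBot
  have coe : ∀ {F : Filter ℕ} {g : ℕ → ℝ}, Tendsto g F (𝓝 c) →
      Tendsto (fun m => (g m : EReal)) F (𝓝 (c : EReal)) := fun h =>
    (continuous_coe_real_ereal.tendsto c).comp h
  apply le_antisymm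
  · have h1 := (coe (hu.mono_left (inf_le_left (b := 𝓟 S)))).limsup_eq
    rw [limsupOver, ← h1]
    refine limsup_le_limsup ?_
    rw [EventuallyLE, eventually_inf_principal]
    filter_upwards [hfu] with m hm hmS
    exact EReal.coe_le_coe_iff.2 (hm hmS)
  · rw [← (coe hv).limsup_eq]
    calc limsup (fun N => (v N : EReal)) atTop
        ≤ limsup (fun N => (f (n N) : EReal)) atTop := by
          refine limsup_le_limsup ?_
          filter_upwards [hvf] with N hN
          exact EReal.coe_le_coe_iff.2 hN
      _ = limsup (fun m => (f m : EReal)) (map n atTop) := rfl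
      _ ≤ limsupOver S f := limsup_le_limsup_of_le hnS'

/-- The primes above `y = log n` have a product dividing `n`, so there are at most `y / log y` of
them, each of weight at most `exp (2/y)`. Below `y`, including all primes with `T` only enlarges the
product, as the weights are at least 1. -/
theorem prod_primeFactors_le {w : ℕ → ℝ} (hw1 : ∀ p : ℕ, p.Prime → 1 ≤ w p)
    (hw2 : ∀ p : ℕ, p.Prime → w p ≤ Real.exp (2 / p)) {T : ℕ → Prop} [DecidablePred T] {n : ℕ}
    (hn : 0 < Real.log (Real.log n)) (hl : 0 < Real.log n)
    (hT : ∀ p ∈ n.primeFactors, T p) :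
    ∏ p ∈ n.primeFactors, w p
      ≤ (∏ p ∈ ⌊Real.log n⌋₊.primesLE with T p, w p) * Real.exp (2 / Real.log (Real.log n)) := by
  have hn0 : n ≠ 0 := by rintro rfl; simp at hl
  set y := Real.log n with hy
  rw [← Finset.prod_filter_mul_prod_filter_not n.primeFactors (fun p => p ≤ ⌊y⌋₊)]
  refine mul_le_mul ?_ ?_ (Finset.prod_nonneg fun p hp => ?_) (Finset.prod_nonneg fun p hp => ?_)
  · have hsub : n.primeFactors.filter (fun p => p ≤ ⌊y⌋₊) ⊆ ⌊y⌋₊.primesLE.filter T := fun p hp => by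
      rw [Finset.mem_filter] at hp
      rw [Finset.mem_filter, Nat.mem_primesLE]
      exact ⟨⟨hp.2, Nat.prime_of_mem_primeFactors hp.1⟩, hT p hp.1⟩
    have hpr : ∀ p ∈ ⌊y⌋₊.primesLE.filter T, 1 ≤ w p := fun p hp =>
      hw1 p (Nat.prime_of_mem_primesLE (Finset.mem_filter.1 hp).1)
    rw [← Finset.prod_sdiff hsub]
    refine le_mul_of_one_le_left
      (Finset.prod_nonneg fun p hp => zero_le_one.trans (hpr p (hsub hp))) ?_
    rw [← Finset.prod_const_one (s := ⌊y⌋₊.primesLE.filter T \ n.primeFactors.filter (· ≤ ⌊y⌋₊))]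
    exact Finset.prod_le_prod (fun _ _ => zero_le_one) fun p hp =>
      hpr p (Finset.sdiff_subset hp)
  · set L := n.primeFactors.filter (fun p => ¬ p ≤ ⌊y⌋₊) with hL
    have hLp : ∀ p ∈ L, p.Prime ∧ y ≤ p := fun p hp => by
      rw [hL, Finset.mem_filter, not_le] at hp
      exact ⟨Nat.prime_of_mem_primeFactors hp.1, (Nat.lt_of_floor_lt hp.2).le⟩
    have hcard : (L.card : ℝ) * Real.log y ≤ y := by
      calc (L.card : ℝ) * Real.log y = ∑ p ∈ L, Real.log y := by simp
        _ ≤ ∑ p ∈ L, Real.log p := Finset.sum_le_sum fun p hp =>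
            Real.log_le_log hl (hLp p hp).2
        _ = Real.log ((∏ p ∈ L, p : ℕ) : ℝ) := by
            rw [Nat.cast_prod, Real.log_prod fun p hp => by exact_mod_cast (hLp p hp).1.ne_zero]
        _ ≤ y := by
            refine Real.log_le_log (by exact_mod_cast Finset.prod_pos fun p hp => (hLp p hp).1.pos) ?_
            have : ∏ p ∈ L, p ∣ n :=
              (Finset.prod_dvd_prod_of_subset _ _ _ (Finset.filter_subset _ _)).trans
                (Nat.prod_primeFactors_dvd n)
            exact_mod_cast Nat.le_of_dvd (Nat.pos_of_ne_zero hn0) this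
    calc ∏ p ∈ L, w p ≤ ∏ p ∈ L, Real.exp (2 / y) := by
          refine Finset.prod_le_prod (fun p hp => zero_le_one.trans (hw1 p (hLp p hp).1))
            fun p hp => (hw2 p (hLp p hp).1).trans (Real.exp_le_exp.2 ?_)
          have := (hLp p hp).2
          gcongr
      _ = Real.exp (L.card * (2 / y)) := by rw [Finset.prod_const, Real.exp_nat_mul]
      _ ≤ _ := by
          refine Real.exp_le_exp.2 ?_
          rw [mul_div_assoc', div_le_div_iff₀ hl hn]
          linarith
  · exact zero_le_one.trans (hw1 p (Nat.prime_of_mem_primeFactors (Finset.mem_filter.1 hp).1))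
  · exact zero_le_one.trans (hw1 p (Nat.prime_of_mem_primesLE (Finset.mem_filter.1 hp).1))

theorem tendsto_log_natCast : Tendsto (fun n : ℕ => Real.log (n : ℝ)) atTop atTop :=
  Real.tendsto_log_atTop.comp tendsto_natCast_atTop_atTop

theorem tendsto_log_log_natCast :
    Tendsto (fun n : ℕ => Real.log (Real.log (n : ℝ))) atTop atTop :=
  Real.tendsto_log_atTop.comp tendsto_log_natCast

theorem exists_tendsto_forall_prod_primeFactors_div_le {w : ℕ → ℝ}
    (hw1 : ∀ p : ℕ, p.Prime → 1 ≤ w p) (hw2 : ∀ p : ℕ, p.Prime → w p ≤ Real.exp (2 / p))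
    (T : ℕ → Prop) [DecidablePred T] {c : ℝ}
    (hc : Tendsto (fun x : ℝ => (∏ p ∈ ⌊x⌋₊.primesLE with T p, w p) / Real.log x) atTop (𝓝 c)) :
    ∃ u : ℕ → ℝ, Tendsto u atTop (𝓝 c) ∧ ∀ᶠ n : ℕ in atTop, 0 < n ∧ 0 < Real.log (Real.log n) ∧
      ((∀ p ∈ n.primeFactors, T p) →
        (∏ p ∈ n.primeFactors, w p) / Real.log (Real.log n) ≤ u n) := by
  refine ⟨fun n => (∏ p ∈ ⌊Real.log n⌋₊.primesLE with T p, w p) / Real.log (Real.log n)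
    * Real.exp (2 / Real.log (Real.log n)), ?_, ?_⟩
  · have h1 := hc.comp tendsto_log_natCast
    have h2 : Tendsto (fun n : ℕ => Real.exp (2 / Real.log (Real.log n))) atTop (𝓝 1) := by
      have := (Real.continuous_exp.tendsto 0).comp
        (tendsto_log_log_natCast.const_div_atTop 2)
      rwa [Real.exp_zero] at this
    simpa using h1.mul h2
  · filter_upwards [tendsto_log_natCast.eventually_gt_atTop 0,
      tendsto_log_log_natCast.eventually_gt_atTop 0, eventually_gt_atTop 0] with n h1 h2 h0
    refine ⟨h0, h2, fun hT => ?_⟩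
    rw [div_mul_eq_mul_div]
    exact div_le_div_of_nonneg_right (prod_primeFactors_le hw1 hw2 h2 h1 hT) h2.le

/-- The crude bound `r m ≤ m` forces `n N → ∞`, because `g` is unbounded. The size bound on `n N`
costs only a `log log N` term in the denominator, negligible against `log N`. -/
theorem tendsto_nat_and_exists_tendsto_le {r : ℕ → ℝ} (hr : ∀ m, r m ≤ m) {n : ℕ → ℕ}
    {g : ℕ → ℝ} {c : ℝ} (hc : 0 < c) (hg : Tendsto (fun N : ℕ => g N / Real.log N) atTop (𝓝 c))
    (hgr : ∀ᶠ N in atTop, g N ≤ r (n N))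
    (hn : ∀ N, n N ≤ 4 ^ (N * (2 * (Nat.log 2 N + 1)))) :
    Tendsto n atTop atTop ∧ ∃ v : ℕ → ℝ, Tendsto v atTop (𝓝 c) ∧
      ∀ᶠ N in atTop, v N ≤ r (n N) / Real.log (Real.log (n N)) := by
  have hgt : Tendsto g atTop atTop := by
    refine (hg.pos_mul_atTop hc tendsto_log_natCast).congr' ?_
    filter_upwards [tendsto_log_natCast.eventually_gt_atTop 0] with N hN
    field_simp
  have hnt : Tendsto n atTop atTop := by
    rw [← tendsto_natCast_atTop_iff (R := ℝ)]
    refine tendsto_atTop_mono' _ ?_ hgt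
    filter_upwards [hgr] with N hN using hN.trans (hr _)
  refine ⟨hnt, fun N => g N / (Real.log N + Real.log (8 * Real.log N)), ?_, ?_⟩
  · have h1 : Tendsto (fun N : ℕ => 1 + (Real.log 8 / Real.log N
        + Real.log (Real.log N) / Real.log N)) atTop (𝓝 1) := by
      have ha := tendsto_log_natCast.const_div_atTop (Real.log 8)
      have hb := (Real.isLittleO_log_id_atTop.tendsto_div_nhds_zero).comp tendsto_log_natCast
      simpa using (ha.add hb).const_add 1
    have h2 := hg.div h1 one_ne_zero
    rw [div_one] at h2
    refine h2.congr' ?_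
    filter_upwards [tendsto_log_natCast.eventually_gt_atTop 0] with N hN
    simp only [Pi.div_apply]
    rw [div_div, Real.log_mul (by norm_num) hN.ne']
    congr 1
    field_simp
  · filter_upwards [hgr, hgt.eventually_ge_atTop 0, eventually_ge_atTop 2,
      (tendsto_log_natCast.comp hnt).eventually_gt_atTop 0,
      (tendsto_log_log_natCast.comp hnt).eventually_gt_atTop 0] with N h1 h2 h3 h4 h5
    simp only [Function.comp_apply] at h4 h5
    have hN2 : (2 : ℝ) ≤ N := by exact_mod_cast h3
    have hl2 : 0 < Real.log 2 := Real.log_pos one_lt_two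
    have hlN : Real.log 2 ≤ Real.log N := Real.log_le_log two_pos hN2
    have hk : (Nat.log 2 N : ℝ) * Real.log 2 ≤ Real.log N := by
      rw [← Real.log_pow]
      exact Real.log_le_log (by positivity)
        (by exact_mod_cast Nat.pow_log_le_self 2 (by omega))
    -- The 8 arises as `2 * 2 * 2`: the exponent's factor, `log 4 = 2 log 2`, and `log N + log 2 ≤ 2
    -- log N`.
    have h6 : Real.log (n N) ≤ N * (8 * Real.log N) := by
      calc Real.log (n N) ≤ Real.log ((4 : ℝ) ^ (N * (2 * (Nat.log 2 N + 1)))) := by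
            refine Real.log_le_log ?_ (by exact_mod_cast hn N)
            rcases Nat.eq_zero_or_pos (n N) with h | h
            · rw [h] at h4; simp at h4
            · exact_mod_cast h
        _ = N * (4 * (Nat.log 2 N * Real.log 2 + Real.log 2)) := by
            rw [Real.log_pow, show (4 : ℝ) = 2 ^ 2 by norm_num, Real.log_pow]
            push_cast; ring
        _ ≤ _ := mul_le_mul_of_nonneg_left (by linarith) (by positivity)
    have h7 : Real.log (Real.log (n N)) ≤ Real.log N + Real.log (8 * Real.log N) := by
      rw [← Real.log_mul (by positivity) (by linarith)]
      exact Real.log_le_log h4 h6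
    exact div_le_div₀ (h2.trans h1) h1 h5 h7

/-! ### Limits of the weighted prime products. -/

theorem tendsto_prod_primesLE_one_sub_inv_sq :
    Tendsto (fun x : ℝ => ∏ p ∈ ⌊x⌋₊.primesLE, (1 - ((p : ℝ)⁻¹) ^ 2)) atTop
      (𝓝 (6 / Real.pi ^ 2)) := by
  have h1 := riemannZeta_eulerProduct (s := 2) (by norm_num)
  rw [riemannZeta_two] at h1
  have h2 := (Complex.continuous_re.tendsto _).comp
    (h1.comp ((tendsto_add_atTop_nat 1).comp (tendsto_nat_floor_atTop (α := ℝ))))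
  have h3 : ((Real.pi : ℂ) ^ 2 / 6).re = Real.pi ^ 2 / 6 := by
    rw [show ((Real.pi : ℂ) ^ 2 / 6) = ((Real.pi ^ 2 / 6 : ℝ) : ℂ) by push_cast; rfl,
      Complex.ofReal_re]
  rw [h3] at h2
  have h4 := h2.inv₀ (by positivity)
  rw [inv_div] at h4
  refine h4.congr fun x => ?_
  have h5 : ∏ p ∈ Nat.primesBelow (⌊x⌋₊ + 1), (1 - (p : ℂ) ^ (-2 : ℂ))⁻¹
      = ((∏ p ∈ ⌊x⌋₊.primesLE, (1 - ((p : ℝ)⁻¹) ^ 2)⁻¹ : ℝ) : ℂ) := by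
    push_cast
    refine Finset.prod_congr rfl fun p hp => ?_
    rw [Complex.cpow_neg]
    norm_num
  simp only [Function.comp_apply]
  rw [h5, Complex.ofReal_re, Finset.prod_inv_distrib, inv_inv]

theorem tendsto_prod_primesLE_one_add_inv_div_log :
    Tendsto (fun x : ℝ => (∏ p ∈ ⌊x⌋₊.primesLE, (1 + (p : ℝ)⁻¹)) / Real.log x) atTop
      (𝓝 (6 * Real.exp Real.eulerMascheroniConstant / Real.pi ^ 2)) := by
  have h := tendsto_prod_primesLE_inv_div_log.mul tendsto_prod_primesLE_one_sub_inv_sq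
  rw [mul_div_assoc', mul_comm _ (6 : ℝ)] at h
  refine h.congr fun x => ?_
  rw [div_mul_eq_mul_div, ← Finset.prod_mul_distrib]
  congr 1
  refine Finset.prod_congr rfl fun p hp => ?_
  have := (Nat.prime_of_mem_primesLE hp).one_sub_inv_pos
  rw [inv_mul_eq_iff_eq_mul₀ this.ne']
  ring

theorem tendsto_prod_odd_primesLE_inv_div_log :
    Tendsto (fun x : ℝ => (∏ p ∈ ⌊x⌋₊.primesLE with p ≠ 2, (1 - (p : ℝ)⁻¹)⁻¹) / Real.log x) atTop
      (𝓝 (Real.exp Real.eulerMascheroniConstant / 2)) := by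
  refine (tendsto_prod_primesLE_inv_div_log.div_const 2).congr' ?_
  filter_upwards [eventually_ge_atTop 2] with x hx
  have h2 : 2 ∈ ⌊x⌋₊.primesLE :=
    Nat.mem_primesLE.2 ⟨Nat.le_floor (by exact_mod_cast hx), Nat.prime_two⟩
  rw [Finset.filter_ne', ← Finset.mul_prod_erase _ _ h2]
  norm_num
  ring

theorem one_sub_inv_inv_bounds {p : ℕ} (hp : p.Prime) :
    1 ≤ (1 - (p : ℝ)⁻¹)⁻¹ ∧ (1 - (p : ℝ)⁻¹)⁻¹ ≤ Real.exp (2 / p) := by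
  have h := hp.one_sub_inv_pos
  have h0 : 0 ≤ (p : ℝ)⁻¹ := by positivity
  have h2 : (p : ℝ)⁻¹ ≤ 1 / 2 := Nat.Primes.inv_le_half ⟨p, hp⟩
  refine ⟨(one_le_inv₀ h).2 (by linarith), ?_⟩
  rw [← Real.log_le_iff_le_exp (by positivity), Real.log_inv, div_eq_mul_inv]
  -- For `u ≤ 1/2` this gives `-log (1 - u) ≤ u + 2u² ≤ 2u`.
  have := logTail_le h2
  unfold logTail at this
  nlinarith

theorem one_add_inv_bounds (p : ℕ) :
    1 ≤ 1 + (p : ℝ)⁻¹ ∧ 1 + (p : ℝ)⁻¹ ≤ Real.exp (2 / p) := by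
  have h0 : 0 ≤ (p : ℝ)⁻¹ := by positivity
  refine ⟨by linarith, ?_⟩
  have := Real.add_one_le_exp (2 / (p : ℝ))
  rw [div_eq_mul_inv] at this ⊢
  linarith

theorem f₁_eq (n : ℕ) :
    f₁ n = (ArithmeticFunction.sigma 1 n : ℝ) / n / Real.log (Real.log n) := by
  rw [f₁, div_div]

theorem f₂_eq (n : ℕ) : f₂ n = (n : ℝ) / n.totient / Real.log (Real.log n) := by
  rw [f₂, div_div]

/-! ### The extremal integers. -/

theorem prod_filter_primesLE_le_four_pow (T : ℕ → Prop) [DecidablePred T] (N : ℕ) :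
    ∏ p ∈ N.primesLE with T p, p ≤ 4 ^ N := by
  refine le_trans ?_ (primorial_le_four_pow N)
  rw [primorial_eq_prod_primesLE]
  exact Finset.prod_le_prod_of_subset_of_one_le' (Finset.filter_subset _ _)
    fun p hp _ => (Nat.prime_of_mem_primesLE hp).one_le

theorem primorial_le_four_pow_mul (N : ℕ) :
    primorial N ≤ 4 ^ (N * (2 * (Nat.log 2 N + 1))) :=
  (primorial_le_four_pow N).trans
    (Nat.pow_le_pow_right (by norm_num) (Nat.le_mul_of_pos_right _ (by omega)))

/-- A high power of the product of the primes up to `N` that satisfy `T`. -/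
def primeProdPow (T : ℕ → Prop) [DecidablePred T] (N : ℕ) : ℕ :=
  (∏ p ∈ N.primesLE with T p, p) ^ (2 * (Nat.log 2 N + 1))

theorem primeProdPow_pos (T : ℕ → Prop) [DecidablePred T] (N : ℕ) : 0 < primeProdPow T N :=
  pow_pos (Finset.prod_pos fun _ hp =>
    (Nat.prime_of_mem_primesLE (Finset.mem_filter.1 hp).1).pos) _

theorem primeProdPow_le_four_pow (T : ℕ → Prop) [DecidablePred T] (N : ℕ) :
    primeProdPow T N ≤ 4 ^ (N * (2 * (Nat.log 2 N + 1))) := by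
  rw [primeProdPow, pow_mul 4 N]
  exact Nat.pow_le_pow_left (prod_filter_primesLE_le_four_pow T N) _

theorem squarefull_primeProdPow (T : ℕ → Prop) [DecidablePred T] (N : ℕ) :
    Squarefull (primeProdPow T N) := by
  refine ⟨primeProdPow_pos T N, fun p hp h => ?_⟩
  have h1 := hp.dvd_of_dvd_pow h
  exact (pow_dvd_pow_of_dvd h1 2).trans (pow_dvd_pow _ (by omega))

theorem odd_primeProdPow (N : ℕ) : Odd (primeProdPow (fun p => p ≠ 2) N) := by
  refine Odd.pow (Finset.prod_induction _ Odd (fun _ _ => Odd.mul) odd_one fun p hp => ?_)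
  rw [Finset.mem_filter] at hp
  exact (Nat.prime_of_mem_primesLE hp.1).odd_of_ne_two hp.2

/-- The exponent is chosen so that `2^(2 (log₂ N + 1)) ≥ N²`. Each factor separating `σ(n) / n` from
`n / φ(n)` is then at least `1 - N⁻²`; there are at most `N` of them, and Bernoulli's inequality
gives `1 - N⁻¹`. -/
theorem mul_prod_le_sigma_primeProdPow (T : ℕ → Prop) [DecidablePred T] {N : ℕ} (hN : N ≠ 0) :
    (1 - (N : ℝ)⁻¹) * ∏ p ∈ N.primesLE with T p, (1 - (p : ℝ)⁻¹)⁻¹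
      ≤ (ArithmeticFunction.sigma 1 (primeProdPow T N) : ℝ) / primeProdPow T N := by
  have hN1 : (1 : ℝ) ≤ N := by exact_mod_cast Nat.one_le_iff_ne_zero.2 hN
  have hTp : ∀ p ∈ N.primesLE.filter T, p.Prime := fun p hp =>
    Nat.prime_of_mem_primesLE (Finset.mem_filter.1 hp).1
  rw [primeProdPow, sigma_one_prod_primes_pow_div_self hTp, Finset.prod_mul_distrib]
  refine mul_le_mul_of_nonneg_right ?_
    (Finset.prod_nonneg fun p hp => by have := (hTp p hp).one_sub_inv_pos; positivity)
  have hsq : ((N : ℝ)⁻¹) ^ 2 ≤ 1 := pow_le_one₀ (by positivity) (inv_le_one_of_one_le₀ hN1)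
  have hcard : (N.primesLE.filter T).card ≤ N := by
    refine (Finset.card_filter_le _ _).trans ?_
    rw [Nat.primesLE_eq_filter_Ioc_zero]
    exact (Finset.card_filter_le _ _).trans (by simp)
  have hterm : ∀ p ∈ N.primesLE.filter T,
      1 - ((N : ℝ)⁻¹) ^ 2 ≤ 1 - ((p : ℝ)⁻¹) ^ (2 * (Nat.log 2 N + 1) + 1) := fun p hp => by
    have hp2 : (2 : ℝ) ≤ p := by exact_mod_cast (hTp p hp).two_le
    have h1 : (N : ℝ) ≤ 2 ^ (Nat.log 2 N + 1) := by
      exact_mod_cast (Nat.lt_pow_succ_log_self one_lt_two N).le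
    have h2 : (N : ℝ) ^ 2 ≤ (p : ℝ) ^ (2 * (Nat.log 2 N + 1) + 1) := by
      calc (N : ℝ) ^ 2 ≤ ((2 : ℝ) ^ (Nat.log 2 N + 1)) ^ 2 := by gcongr
        _ = 2 ^ (2 * (Nat.log 2 N + 1)) := by rw [← pow_mul, mul_comm]
        _ ≤ (p : ℝ) ^ (2 * (Nat.log 2 N + 1)) := by gcongr
        _ ≤ _ := pow_le_pow_right₀ (by linarith) (by omega)
    have h3 := inv_anti₀ (by positivity) h2
    rw [← inv_pow, ← inv_pow] at h3
    linarith
  calc 1 - (N : ℝ)⁻¹ = 1 + N * (-((N : ℝ)⁻¹) ^ 2) := by field_simp; ring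
    _ ≤ (1 + -((N : ℝ)⁻¹) ^ 2) ^ N := one_add_mul_le_pow (by linarith) N
    _ ≤ (1 + -((N : ℝ)⁻¹) ^ 2) ^ (N.primesLE.filter T).card :=
        pow_le_pow_of_le_one (by linarith) (by linarith [sq_nonneg (N : ℝ)⁻¹]) hcard
    _ = ∏ p ∈ N.primesLE.filter T, (1 - ((N : ℝ)⁻¹) ^ 2) := by
        rw [Finset.prod_const, sub_eq_add_neg]
    _ ≤ _ := Finset.prod_le_prod (fun _ _ => by linarith) hterm

theorem sigma_one_div_self_le_self (m : ℕ) : (ArithmeticFunction.sigma 1 m : ℝ) / m ≤ m :=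
  (sigma_one_div_self_le_div_totient m).trans (Nat.cast_div_totient_le_self m)

/-! ### Evaluation of the upper limits. -/

/-- Since `f₁ ≤ f₂` eventually, the upper bound for `f₂` and the lower bound for `f₁` along
`primeProdPow T` settle both functions. -/
theorem limsupOver_f₁_f₂_eq {S : Set ℕ} {T : ℕ → Prop} [DecidablePred T] {c : ℝ} (hc : 0 < c)
    (hT : Tendsto (fun x : ℝ => (∏ p ∈ ⌊x⌋₊.primesLE with T p, (1 - (p : ℝ)⁻¹)⁻¹) / Real.log x)
      atTop (𝓝 c))
    (hST : ∀ n ∈ S, ∀ p ∈ n.primeFactors, T p) (hS : ∀ N, primeProdPow T N ∈ S) :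
    limsupOver S f₁ = (c : EReal) ∧ limsupOver S f₂ = (c : EReal) := by
  obtain ⟨u, hu, hup⟩ := exists_tendsto_forall_prod_primeFactors_div_le
    (fun p hp => (one_sub_inv_inv_bounds hp).1) (fun p hp => (one_sub_inv_inv_bounds hp).2) T hT
  have hg : Tendsto (fun N : ℕ => ((1 - (N : ℝ)⁻¹) * ∏ p ∈ N.primesLE with T p, (1 - (p : ℝ)⁻¹)⁻¹)
      / Real.log N) atTop (𝓝 c) := by
    have h1 := (tendsto_inv_atTop_nhds_zero_nat (𝕜 := ℝ)).const_sub 1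
    have h2 := h1.mul (hT.comp tendsto_natCast_atTop_atTop)
    rw [sub_zero, one_mul] at h2
    refine h2.congr fun N => ?_
    simp only [Function.comp_apply, Nat.floor_natCast, mul_div_assoc]
  obtain ⟨hn, v, hv, hvf⟩ := tendsto_nat_and_exists_tendsto_le
    (r := fun m => (ArithmeticFunction.sigma 1 m : ℝ) / m) sigma_one_div_self_le_self hc hg
    (by filter_upwards [eventually_ne_atTop 0] with N hN using mul_prod_le_sigma_primeProdPow T hN)
    (primeProdPow_le_four_pow T)
  have h12 : ∀ᶠ n : ℕ in atTop, f₁ n ≤ f₂ n := by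
    filter_upwards [tendsto_log_log_natCast.eventually_ge_atTop 0] with n h
    rw [f₁_eq, f₂_eq]
    exact div_le_div_of_nonneg_right (sigma_one_div_self_le_div_totient n) h
  have hf2 : ∀ᶠ n : ℕ in atTop, n ∈ S → f₂ n ≤ u n := by
    filter_upwards [hup] with n h hnS
    rw [f₂_eq, Nat.cast_div_totient_eq_prod n h.1.ne']
    exact h.2.2 (hST n hnS)
  have hf1 : ∀ᶠ N in atTop, v N ≤ f₁ (primeProdPow T N) := by
    filter_upwards [hvf] with N h
    rwa [f₁_eq]
  refine ⟨limsupOver_eq_of_tendsto ?_ hu hn (Eventually.of_forall hS) hf1 hv,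
    limsupOver_eq_of_tendsto hf2 hu hn (Eventually.of_forall hS) ?_ hv⟩
  · filter_upwards [h12, hf2] with n h h' hnS using h.trans (h' hnS)
  · filter_upwards [hf1, hn.eventually h12] with N h h' using h.trans h'

/-- High prime powers are excluded here, so the two ratios carry different weights `w`; the
primorials attain the full product exactly. -/
theorem limsupOver_squarefree_eq {r w : ℕ → ℝ} (hr : ∀ m, r m ≤ m)
    (hrw : ∀ m, Squarefree m → r m = ∏ p ∈ m.primeFactors, w p)
    (hw : ∀ p : ℕ, p.Prime → 1 ≤ w p ∧ w p ≤ Real.exp (2 / p)) {c : ℝ} (hc : 0 < c)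
    (hT : Tendsto (fun x : ℝ => (∏ p ∈ ⌊x⌋₊.primesLE, w p) / Real.log x) atTop (𝓝 c)) :
    limsupOver {n | Squarefree n} (fun n => r n / Real.log (Real.log n)) = (c : EReal) := by
  obtain ⟨u, hu, hup⟩ := exists_tendsto_forall_prod_primeFactors_div_le
    (fun p hp => (hw p hp).1) (fun p hp => (hw p hp).2) (fun _ => True) (by simpa using hT)
  have hg : Tendsto (fun N : ℕ => (∏ p ∈ N.primesLE, w p) / Real.log N) atTop (𝓝 c) := by
    refine (hT.comp tendsto_natCast_atTop_atTop).congr fun N => ?_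
    simp only [Function.comp_apply, Nat.floor_natCast]
  obtain ⟨hn, v, hv, hvf⟩ := tendsto_nat_and_exists_tendsto_le hr hc hg (n := primorial)
    (Eventually.of_forall fun N => by
      rw [hrw _ (squarefree_primorial N), primeFactors_primorial]) primorial_le_four_pow_mul
  refine limsupOver_eq_of_tendsto ?_ hu hn (Eventually.of_forall squarefree_primorial) hvf hv
  filter_upwards [hup] with n h hnS
  rw [hrw n hnS]
  exact h.2.2 fun _ _ => trivial

theorem theorem9 :
    -- over all positive integers, over squarefree integers, over odd integers: the ratio f₁
    (limsupOver {n | 0 < n} f₁ = ((Real.exp Real.eulerMascheroniConstant : ℝ) : EReal) ∧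
      limsupOver {n | Squarefree n} f₁
        = ((6 * Real.exp Real.eulerMascheroniConstant / Real.pi ^ 2 : ℝ) : EReal) ∧
      limsupOver {n | Odd n} f₁
        = ((Real.exp Real.eulerMascheroniConstant / 2 : ℝ) : EReal)) ∧
    -- the same for the ratio f₂
    (limsupOver {n | 0 < n} f₂ = ((Real.exp Real.eulerMascheroniConstant : ℝ) : EReal) ∧
      limsupOver {n | Squarefree n} f₂
        = ((Real.exp Real.eulerMascheroniConstant : ℝ) : EReal) ∧
      limsupOver {n | Odd n} f₂
        = ((Real.exp Real.eulerMascheroniConstant / 2 : ℝ) : EReal)) ∧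
    -- over squarefull integers
    (limsupOver {n | Squarefull n} f₁
        = ((Real.exp Real.eulerMascheroniConstant : ℝ) : EReal) ∧
      limsupOver {n | Squarefull n} f₂
        = ((Real.exp Real.eulerMascheroniConstant : ℝ) : EReal)) := by
  have hM := tendsto_prod_primesLE_inv_div_log
  have hM' : Tendsto (fun x : ℝ => (∏ p ∈ ⌊x⌋₊.primesLE with True, (1 - (p : ℝ)⁻¹)⁻¹)
      / Real.log x) atTop (𝓝 (Real.exp Real.eulerMascheroniConstant)) := by simpa using hM
  have hall := limsupOver_f₁_f₂_eq (S := {n | 0 < n}) (Real.exp_pos _) hM'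
    (fun _ _ _ _ => trivial) (primeProdPow_pos _)
  have hfull := limsupOver_f₁_f₂_eq (S := {n | Squarefull n}) (Real.exp_pos _) hM'
    (fun _ _ _ _ => trivial) (squarefull_primeProdPow _)
  have hodd := limsupOver_f₁_f₂_eq (S := {n | Odd n}) (by positivity)
    tendsto_prod_odd_primesLE_inv_div_log
    (fun n (hn : Odd n) p hp h2 => by
      subst h2
      exact Nat.not_even_iff_odd.2 hn (even_iff_two_dvd.2 (Nat.dvd_of_mem_primeFactors hp)))
    odd_primeProdPow
  have hsf₁ := limsupOver_squarefree_eq sigma_one_div_self_le_self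
    (fun _ => sigma_one_div_self_of_squarefree) (fun p _ => one_add_inv_bounds p)
    (by positivity) tendsto_prod_primesLE_one_add_inv_div_log
  have hsf₂ := limsupOver_squarefree_eq Nat.cast_div_totient_le_self
    (fun m hm => Nat.cast_div_totient_eq_prod m hm.ne_zero) (fun p => one_sub_inv_inv_bounds)
    (Real.exp_pos _) hM
  rw [← funext f₁_eq] at hsf₁
  rw [← funext f₂_eq] at hsf₂
  exact ⟨⟨hall.1, hsf₁, hodd.1⟩, ⟨hall.2, hsf₂, hodd.2⟩, hfull.1, hfull.2⟩
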